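/- Let $J_\nu$ and $Y_\nu$ be the Bessel functions of the first and second kind. Let $$s_{\mu,\nu}(z)=\frac{z^{\mu+1}}{(\mu-\nu+1)(\mu+\nu+1)}\,{}_1F_2\left(1;\tfrac{\mu-\nu+3}{2},\tfrac{\mu+\nu+3}{2};-\tfrac{z^2}{4}\right),$$ and let the Lommel function $S_{\mu,\nu}(z)$ be defined, when neither $\mu+\nu$ nor $\mu-\nu$ is an odd negative integer, by $$S_{\mu,\nu}(z)=s_{\mu,\nu}(z)+\frac{2^{\mu-1}\Gamma\left(\frac{\mu-\nu+1}{2}\right)\Gamma\left(\frac{\mu+\nu+1}{2}\right)}{\sin(\nu\pi)}\left\{\cos\left(\tfrac{(\mu-\nu)\pi}{2}\right)J_{-\nu}(z)-\cos\left(\tfrac{(\mu+\nu)\pi}{2}\right)J_{\nu}(z)\right\}$$ for $\nu\notin\mathbb{Z}$ and by $$S_{\mu,\nu}(z)=s_{\mu,\nu}(z)+2^{\mu-1}\Gamma\left(\tfrac{\mu-\nu+1}{2}\right)\Gamma\left(\tfrac{\mu+\nu+1}{2}\right)\left\{\sin\left(\tfrac{(\mu-\nu)\pi}{2}\right)J_{\nu}(z)-\cos\left(\tfrac{(\mu-\nu)\pi}{2}\right)Y_{\nu}(z)\right\}$$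 for $\nu\in\mathbb{Z}$. If $\mu+\nu$ or $\mu-\nu$ is an odd negative integer, then $S_{\mu,\nu}(z)$ denotes the limit of $S_{\mu',\nu}(z)$ as $\mu'\to\mu$, $\mu'\neq\mu$. Lemma 2.1. For every integer $k\ge 1$, every real $a>0$ and every $s\in\mathbb{C}$, the integral below converges absolutely and $$\int_0^\infty \frac{e^{-2\pi kx}\sin\left(s\arctan(x/a)\right)}{(a^2+x^2)^{s/2}}\,dx=s\sqrt{a}\,(2\pi k)^{s-\frac12}\,S_{-s-\frac12,\frac12}(2\pi ak),$$ where, for $s\in\{0,1,2,\dots\}$, the limit that defines $S_{-s-\frac12,\frac12}(2\pi ak)$ exists. All powers are principal. -/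

import Mathlib

open Filter Topology

noncomputable section

/-- The generalized hypergeometric function `₁F₂(a; b, c; z) = ∑ (a)ₙ / ((b)ₙ (c)ₙ) zⁿ / n!`,
for `b`, `c` not in `{0, -1, -2, …}`: Mathlib's regularized function times the
normalizing factor `Γ(b) Γ(c)`. -/
def hypergeometric1F2 (a b c z : ℂ) : ℂ :=
  Complex.Gamma b * Complex.Gamma c * Complex.regularizedHGFun {a} {b, c} z

/-- The Bessel function of the first kind (principal branch),
`J_ν(z) = ∑ (-1)ᵐ / (m! Γ(ν + m + 1)) (z/2)^(ν + 2m)` for `z ≠ 0`. Mathlib's `Complex.Gamma` is `0`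
at the poles of `Γ`, so that the terms with a pole of `Γ` vanish, as they should. -/
def besselJ (ν z : ℂ) : ℂ :=
  (z / 2) ^ ν * ∑' m : ℕ,
    (-1) ^ m / ((m.factorial : ℂ) * Complex.Gamma (ν + m + 1)) * (z / 2) ^ (2 * m)

/-- The quotient defining the Bessel function of the second kind at a non-integral order. -/
def besselYQuotient (ν z : ℂ) : ℂ :=
  (besselJ ν z * Complex.cos (ν * Real.pi) - besselJ (-ν) z) / Complex.sin (ν * Real.pi)

open Classical in
/-- The Bessel function of the second kind `Y_ν(z)`, `z ≠ 0`; at an integral order it is the limit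
of the values at the nearby non-integral orders. -/
def besselY (ν z : ℂ) : ℂ :=
  if ∃ n : ℤ, ν = n then limUnder (𝓝[≠] ν) (fun ν' => besselYQuotient ν' z)
  else besselYQuotient ν z

/-- The Lommel function `s_{μ,ν}(z)`, `z ≠ 0`. -/
def smallLommel (μ ν z : ℂ) : ℂ :=
  z ^ (μ + 1) / ((μ - ν + 1) * (μ + ν + 1)) *
    hypergeometric1F2 1 (μ / 2 - ν / 2 + 3 / 2) (μ / 2 + ν / 2 + 3 / 2) (-(z ^ 2 / 4))

open Classical in
/-- The explicit expression for the Lommel function `S_{μ,ν}(z)`, which makes sense when neither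
`μ + ν` nor `μ - ν` is an odd negative integer. -/
def lommelFormula (μ ν z : ℂ) : ℂ :=
  if ∃ n : ℤ, ν = n then
    smallLommel μ ν z +
      2 ^ (μ - 1) * Complex.Gamma ((μ - ν + 1) / 2) * Complex.Gamma ((μ + ν + 1) / 2) *
        (Complex.sin ((μ - ν) * Real.pi / 2) * besselJ ν z -
          Complex.cos ((μ - ν) * Real.pi / 2) * besselY ν z)
  else
    smallLommel μ ν z +
      2 ^ (μ - 1) * Complex.Gamma ((μ - ν + 1) / 2) * Complex.Gamma ((μ + ν + 1) / 2) /
          Complex.sin (ν * Real.pi) *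
        (Complex.cos ((μ - ν) * Real.pi / 2) * besselJ (-ν) z -
          Complex.cos ((μ + ν) * Real.pi / 2) * besselJ ν z)

/-- `μ + ν` or `μ - ν` is an odd negative integer. -/
def LommelExceptional (μ ν : ℂ) : Prop :=
  ∃ n : ℕ, μ + ν = -(2 * (n : ℂ) + 1) ∨ μ - ν = -(2 * (n : ℂ) + 1)

open Classical in
/-- The Lommel function `S_{μ,ν}(z)`, `z ≠ 0`: given by the explicit expression, and, if `μ + ν` or
`μ - ν` is an odd negative integer, by the limit of that expression as the first index
tends to `μ`. -/
def lommelS (μ ν z : ℂ) : ℂ :=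
  if LommelExceptional μ ν then limUnder (𝓝[≠] μ) (fun μ' => lommelFormula μ' ν z)
  else lommelFormula μ ν z

end

noncomputable section

open MeasureTheory Set

/-! Under x = a t the integrand becomes, up to a power of a, e^{-zt} ((1 - it)^{-s} - (1 + it)^{-s})
/ (2i) with z = 2πka (`integrand_comp_mul`). So everything reduces to L(s, z) = ∫₀^∞ e^{-zt} (1 +
εt)^{-s} dt with ε = ±i.

Differentiation in z and integration by parts each relate L(s - 1, z) to L(s, z); eliminating L(s -
1, z) leaves a first-order linear equation in z. A multiple of `gammaSeries` is a particular
solution. For Re s < 0 the behaviour as z → 0⁺ fixes the homogeneous part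
(`laplaceCpow_eq_of_re_neg`), and the recurrence in s carries the closed form to all s outside {1,
2, …} (`laplaceCpow_eq`).

In the difference of the two transforms the odd powers of z in the series cancel. By the duplication
formula the even ones form the ₁F₂ of s_{μ,ν}, while the exponentials combine to sin(z + πs/2),
which is the contribution of J_{±1/2} (`mul_lommelFormula`).

This settles s outside {0, 1, 2, …}. The transform is entire in s and vanishes at s = 0, so its
quotient by s extends continuously to all s. Hence the defining limit exists at each exceptional s
and the identity persists there (`tendsto_lommelFormula_half`, `lommelS_half_eq`). -/

/-! ### Growth of (1 + εt)^{-s} for ε = ±i -/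

theorem norm_eq_one_of_sq {ε : ℂ} (hε : ε ^ 2 = -1) : ‖ε‖ = 1 := by
  have h : ‖ε‖ ^ 2 = 1 := by rw [← norm_pow, hε]; simp
  nlinarith [norm_nonneg ε]

theorem re_one_add_mul {ε : ℂ} (hre : ε.re = 0) (t : ℝ) : (1 + ε * t).re = 1 := by
  simp [hre]

theorem one_add_mul_mem_slitPlane {ε : ℂ} (hre : ε.re = 0) (t : ℝ) :
    1 + ε * t ∈ Complex.slitPlane := Or.inl (by rw [re_one_add_mul hre]; norm_num)

theorem norm_log_one_add_mul_le {ε : ℂ} (hre : ε.re = 0) (hε : ε ^ 2 = -1) {t : ℝ} (ht : 0 ≤ t) :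
    ‖Complex.log (1 + ε * t)‖ ≤ Real.log (1 + t) + Real.pi := by
  have h1 : 1 ≤ ‖1 + ε * t‖ := by
    have := Complex.abs_re_le_norm (1 + ε * t)
    rwa [re_one_add_mul hre, abs_one] at this
  have h2 : ‖1 + ε * t‖ ≤ 1 + t := by
    refine (norm_add_le _ _).trans ?_
    simp [norm_eq_one_of_sq hε, abs_of_nonneg ht]
  refine (Complex.norm_le_abs_re_add_abs_im _).trans ?_
  rw [Complex.log_re, Complex.log_im, abs_of_nonneg (Real.log_nonneg h1)]
  exact add_le_add (Real.log_le_log (by linarith) h2) (Complex.abs_arg_le_pi _)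

/-- This is log x ≤ x - 1 at x = δ(1 + t)/M, multiplied by M. -/
theorem exists_mul_log_one_add_le {M δ : ℝ} (hM : 0 < M) (hδ : 0 < δ) :
    ∃ C, ∀ t : ℝ, 0 ≤ t → M * Real.log (1 + t) ≤ C + δ * t := by
  refine ⟨δ - M - M * Real.log (δ / M), fun t ht => ?_⟩
  have h := Real.log_le_sub_one_of_pos (x := δ / M * (1 + t)) (by positivity)
  rw [Real.log_mul (by positivity) (by positivity)] at h
  have h2 := mul_le_mul_of_nonneg_left h hM.le
  have h3 : M * (δ / M * (1 + t) - 1) = δ * (1 + t) - M := by field_simp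
  rw [h3] at h2
  linarith

/-- The factor 1 + ‖log‖ is there to dominate the derivative in s as well; it costs only one more
power of e^{‖log‖}. Uniformity over ‖s‖ ≤ R is what differentiation under the integral needs. -/
theorem exists_norm_cpow_le {ε : ℂ} (hre : ε.re = 0) (hε : ε ^ 2 = -1) {R δ : ℝ} (hR : 0 ≤ R)
    (hδ : 0 < δ) : ∃ C : ℝ, ∀ t : ℝ, 0 ≤ t → ∀ s : ℂ, ‖s‖ ≤ R →
      (1 + ‖Complex.log (1 + ε * t)‖) * ‖(1 + ε * t) ^ (-s)‖ ≤ C * Real.exp (δ * t) := by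
  obtain ⟨C, hC⟩ := exists_mul_log_one_add_le (M := R + 1) (by linarith) hδ
  refine ⟨Real.exp (C + (R + 1) * Real.pi), fun t ht s hs => ?_⟩
  set l := Complex.log (1 + ε * t) with hl
  have h1 : ‖(1 + ε * t) ^ (-s)‖ ≤ Real.exp (R * ‖l‖) := by
    rw [Complex.cpow_def_of_ne_zero (Complex.slitPlane_ne_zero (one_add_mul_mem_slitPlane hre t)),
      ← hl]
    refine (Complex.norm_exp_le_exp_norm _).trans ?_
    rw [norm_mul, norm_neg, mul_comm]
    gcongr
  have h2 : 1 + ‖l‖ ≤ Real.exp ‖l‖ := by rw [add_comm]; exact Real.add_one_le_exp _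
  calc (1 + ‖l‖) * ‖(1 + ε * t) ^ (-s)‖ ≤ Real.exp ‖l‖ * Real.exp (R * ‖l‖) := by gcongr
    _ = Real.exp ((R + 1) * ‖l‖) := by rw [← Real.exp_add]; ring_nf
    _ ≤ Real.exp (C + (R + 1) * Real.pi + δ * t) := by
        have := mul_le_mul_of_nonneg_left (norm_log_one_add_mul_le hre hε ht)
          (by linarith : 0 ≤ R + 1)
        have := hC t ht
        gcongr
        linarith
    _ = _ := by rw [Real.exp_add]

/-! ### The Laplace transform of (1 + εt)^{-s}: analyticity, derivative, recurrence -/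

/-- The integrand of `laplaceCpow`. -/
def laplaceCpowKernel (ε s : ℂ) (z t : ℝ) : ℂ := (Real.exp (-z * t) : ℂ) * (1 + ε * t) ^ (-s)

/-- The Laplace transform of `t ↦ (1 + ε t) ^ (-s)`. -/
def laplaceCpow (ε s : ℂ) (z : ℝ) : ℂ := ∫ t in Ioi (0 : ℝ), laplaceCpowKernel ε s z t

theorem continuous_one_add_mul_cpow {ε : ℂ} (hre : ε.re = 0) (s : ℂ) :
    Continuous fun t : ℝ => (1 + ε * t) ^ (-s) := by
  refine continuous_iff_continuousAt.2 fun t => ?_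
  exact ContinuousAt.cpow (by fun_prop) (by fun_prop) (one_add_mul_mem_slitPlane hre t)

theorem continuous_laplaceCpowKernel {ε : ℂ} (hre : ε.re = 0) (s : ℂ) (z : ℝ) :
    Continuous (laplaceCpowKernel ε s z) := by
  have := continuous_one_add_mul_cpow hre s
  unfold laplaceCpowKernel
  fun_prop

/-- Of the decay e^{-2δt}, one half absorbs the growth of the power and the other half remains as an
integrable bound, uniform in z ≥ 2δ. -/
theorem exists_norm_laplaceCpowKernel_le {ε : ℂ} (hre : ε.re = 0) (hε : ε ^ 2 = -1) {R δ : ℝ}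
    (hR : 0 ≤ R) (hδ : 0 < δ) : ∃ C : ℝ, ∀ z t : ℝ, 2 * δ ≤ z → 0 ≤ t → ∀ s : ℂ, ‖s‖ ≤ R →
      (1 + ‖Complex.log (1 + ε * t)‖) * ‖laplaceCpowKernel ε s z t‖ ≤ C * Real.exp (-δ * t) := by
  obtain ⟨C, hC⟩ := exists_norm_cpow_le hre hε hR hδ
  refine ⟨C, fun z t hz ht s hs => ?_⟩
  rw [laplaceCpowKernel, norm_mul, Complex.norm_real, Real.norm_eq_abs, Real.abs_exp,
    mul_left_comm]
  have h1 : Real.exp (-z * t) ≤ Real.exp (-(2 * δ) * t) := by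
    gcongr
  calc _ ≤ Real.exp (-(2 * δ) * t) * (C * Real.exp (δ * t)) := by
        exact mul_le_mul h1 (hC t ht s hs) (by positivity) (by positivity)
    _ = C * Real.exp (-δ * t) := by
        rw [mul_left_comm, ← Real.exp_add]; ring_nf

theorem exists_norm_laplaceCpowKernel_le' {ε : ℂ} (hre : ε.re = 0) (hε : ε ^ 2 = -1) {δ : ℝ}
    (hδ : 0 < δ) (s : ℂ) : ∃ C : ℝ, ∀ z t : ℝ, 2 * δ ≤ z → 0 ≤ t →
      ‖laplaceCpowKernel ε s z t‖ ≤ C * Real.exp (-δ * t) := by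
  obtain ⟨C, hC⟩ := exists_norm_laplaceCpowKernel_le hre hε (norm_nonneg s) hδ
  refine ⟨C, fun z t hz ht => le_trans ?_ (hC z t hz ht s le_rfl)⟩
  exact le_mul_of_one_le_left (norm_nonneg _) (by linarith [norm_nonneg (Complex.log (1 + ε * t))])

theorem integrableOn_const_mul_exp_neg (C : ℝ) {δ : ℝ} (hδ : 0 < δ) :
    IntegrableOn (fun t : ℝ => C * Real.exp (-δ * t)) (Ioi 0) :=
  (exp_neg_integrableOn_Ioi 0 hδ).const_mul C

theorem integrableOn_laplaceCpowKernel {ε : ℂ} (hre : ε.re = 0) (hε : ε ^ 2 = -1) (s : ℂ) {z : ℝ}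
    (hz : 0 < z) : IntegrableOn (laplaceCpowKernel ε s z) (Ioi 0) := by
  obtain ⟨C, hC⟩ := exists_norm_laplaceCpowKernel_le' hre hε (half_pos hz) s
  refine (integrableOn_const_mul_exp_neg C (half_pos hz)).mono'
    (continuous_laplaceCpowKernel hre s z).aestronglyMeasurable ?_
  filter_upwards [ae_restrict_mem measurableSet_Ioi] with t ht
  exact hC z t (by linarith) (le_of_lt ht)

theorem differentiable_laplaceCpow {ε : ℂ} (hre : ε.re = 0) (hε : ε ^ 2 = -1) {z : ℝ}
    (hz : 0 < z) : Differentiable ℂ fun s => laplaceCpow ε s z := by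
  intro s
  obtain ⟨C, hC⟩ := exists_norm_laplaceCpowKernel_le hre hε (R := ‖s‖ + 1) (by positivity)
    (half_pos hz)
  have hlog : Continuous fun t : ℝ => Complex.log (1 + ε * t) := by
    refine continuous_iff_continuousAt.2 fun t => ?_
    exact ContinuousAt.clog (by fun_prop) (one_add_mul_mem_slitPlane hre t)
  refine (hasDerivAt_integral_of_dominated_loc_of_deriv_le
    (F' := fun s t => -Complex.log (1 + ε * t) * laplaceCpowKernel ε s z t)
    (Metric.ball_mem_nhds s one_pos)
    (.of_forall fun s' => (continuous_laplaceCpowKernel hre s' z).aestronglyMeasurable)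
    (integrableOn_laplaceCpowKernel hre hε s hz)
    (hlog.neg.mul (continuous_laplaceCpowKernel hre s z)).aestronglyMeasurable ?_
    (integrableOn_const_mul_exp_neg C (half_pos hz)) ?_).2.differentiableAt
  · filter_upwards [ae_restrict_mem measurableSet_Ioi] with t ht s' hs'
    rw [norm_mul, norm_neg]
    refine le_trans ?_ (hC z t (by linarith) (le_of_lt ht) s' ?_)
    · gcongr
      linarith
    · rw [Metric.mem_ball, dist_eq_norm] at hs'
      have := norm_add_le (s' - s) s
      rw [sub_add_cancel] at this
      linarith
  · refine .of_forall fun t s' _ => ?_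
    have h := ((hasDerivAt_neg s').const_cpow (c := 1 + ε * t)
      (Or.inl (Complex.slitPlane_ne_zero (one_add_mul_mem_slitPlane hre t)))).const_mul
      (Real.exp (-z * t) : ℂ)
    refine h.congr_deriv ?_
    rw [laplaceCpowKernel]
    ring

/-- Since ε² = -1, t = -ε((1 + εt) - 1). Thus the factor t produced by differentiating in z becomes
a shift of s. -/
theorem ofReal_mul_one_add_mul_cpow {ε : ℂ} (hre : ε.re = 0) (hε : ε ^ 2 = -1) (s : ℂ) (t : ℝ) :
    (t : ℂ) * (1 + ε * t) ^ (-s) = -ε * ((1 + ε * t) ^ (-(s - 1)) - (1 + ε * t) ^ (-s)) := by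
  have h : (1 + ε * t) ^ (-(s - 1)) = (1 + ε * t) ^ (-s) * (1 + ε * t) := by
    rw [show -(s - 1) = -s + 1 by ring,
      Complex.cpow_add _ _ (Complex.slitPlane_ne_zero (one_add_mul_mem_slitPlane hre t)),
      Complex.cpow_one]
  rw [h]
  linear_combination ((t : ℂ) * (1 + ε * t) ^ (-s)) * hε

theorem hasDerivAt_laplaceCpow {ε : ℂ} (hre : ε.re = 0) (hε : ε ^ 2 = -1) (s : ℂ) {z : ℝ}
    (hz : 0 < z) :
    HasDerivAt (fun z => laplaceCpow ε s z)
      (ε * (laplaceCpow ε (s - 1) z - laplaceCpow ε s z)) z := by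
  -- On the neighbourhood z' > z/2 the uniform bounds apply with 2δ = z/2.
  obtain ⟨C₁, hC₁⟩ := exists_norm_laplaceCpowKernel_le' hre hε (by positivity : 0 < z / 4) (s - 1)
  obtain ⟨C₂, hC₂⟩ := exists_norm_laplaceCpowKernel_le' hre hε (by positivity : 0 < z / 4) s
  have h := (hasDerivAt_integral_of_dominated_loc_of_deriv_le (𝕜 := ℝ) (x₀ := z)
    (μ := volume.restrict (Ioi (0 : ℝ))) (F := fun z t => laplaceCpowKernel ε s z t)
    (F' := fun z t => ε * (laplaceCpowKernel ε (s - 1) z t - laplaceCpowKernel ε s z t))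
    (bound := fun t => (C₁ + C₂) * Real.exp (-(z / 4) * t))
    (Ioi_mem_nhds (half_lt_self hz))
    (.of_forall fun z => (continuous_laplaceCpowKernel hre s z).aestronglyMeasurable)
    (integrableOn_laplaceCpowKernel hre hε s hz)
    (((continuous_laplaceCpowKernel hre (s - 1) z).sub
      (continuous_laplaceCpowKernel hre s z)).const_mul ε).aestronglyMeasurable ?_
    (integrableOn_const_mul_exp_neg _ (by positivity)) ?_).2
  · refine h.congr_deriv ?_
    rw [integral_const_mul, integral_sub (integrableOn_laplaceCpowKernel hre hε _ hz)
      (integrableOn_laplaceCpowKernel hre hε _ hz)]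
    rfl
  · filter_upwards [ae_restrict_mem measurableSet_Ioi] with t ht z' hz'
    rw [norm_mul, norm_eq_one_of_sq hε, one_mul, add_mul]
    have hz'' : z / 2 < z' := hz'
    exact (norm_sub_le _ _).trans (add_le_add (hC₁ z' t (by linarith) (le_of_lt ht))
      (hC₂ z' t (by linarith) (le_of_lt ht)))
  · refine .of_forall fun t z' _ => ?_
    have h1 : HasDerivAt (fun x : ℝ => Real.exp (-x * t)) (Real.exp (-z' * t) * (-1 * t)) z' :=
      ((hasDerivAt_neg z').mul_const t).exp
    have h2 := (h1.ofReal_comp).mul_const ((1 + ε * t) ^ (-s))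
    refine h2.congr_deriv ?_
    simp only [laplaceCpowKernel]
    have := ofReal_mul_one_add_mul_cpow hre hε s t
    push_cast
    linear_combination (-Complex.exp (-z' * t)) * this

/-- Integration by parts: integrate the t-derivative of the kernel at s - 1 over (0, ∞). The 1 is
its boundary value at t = 0. -/
theorem mul_laplaceCpow_sub_one {ε : ℂ} (hre : ε.re = 0) (hε : ε ^ 2 = -1) (s : ℂ) {z : ℝ}
    (hz : 0 < z) :
    z * laplaceCpow ε (s - 1) z = 1 + ε * (1 - s) * laplaceCpow ε s z := by
  obtain ⟨C, hC⟩ := exists_norm_laplaceCpowKernel_le' hre hε (half_pos hz) (s - 1)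
  have h1 := integrableOn_laplaceCpowKernel hre hε (s - 1) hz
  have h2 := integrableOn_laplaceCpowKernel hre hε s hz
  have key := integral_Ioi_of_hasDerivAt_of_tendsto' (a := 0) (m := 0)
    (f := fun t => laplaceCpowKernel ε (s - 1) z t)
    (f' := fun t => ε * (1 - s) * laplaceCpowKernel ε s z t - z * laplaceCpowKernel ε (s - 1) z t)
    ?_ ((h2.const_mul _).sub (h1.const_mul _)) ?_
  · rw [integral_sub (h2.const_mul _) (h1.const_mul _), integral_const_mul, integral_const_mul]
      at key
    change ε * (1 - s) * laplaceCpow ε s z - z * laplaceCpow ε (s - 1) z = _ at key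
    simp [laplaceCpowKernel] at key
    linear_combination -key
  · intro t _
    have e1 : HasDerivAt (fun x : ℝ => Real.exp (-z * x)) (Real.exp (-z * t) * (-z * 1)) t :=
      ((hasDerivAt_id t).const_mul (-z)).exp
    have e2 : HasDerivAt (fun x : ℝ => 1 + ε * (x : ℂ)) (ε * 1) t := by
      simpa using! ((hasDerivAt_id t).ofReal_comp.const_mul ε).const_add 1
    have e3 : HasDerivAt (fun w : ℂ => w ^ (-(s - 1)))
        (-(s - 1) * (1 + ε * t) ^ (-(s - 1) - 1)) (1 + ε * t) :=
      (Complex.hasStrictDerivAt_cpow_const (one_add_mul_mem_slitPlane hre t)).hasDerivAt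
    have e4 := (e1.ofReal_comp).mul (e3.comp t e2)
    refine e4.congr_deriv ?_
    simp only [laplaceCpowKernel, Function.comp]
    rw [show -(s - 1) - 1 = -s by ring]
    push_cast
    ring
  · refine squeeze_zero_norm' (a := fun t => C * Real.exp (-(z / 2) * t)) ?_ ?_
    · filter_upwards [eventually_ge_atTop 0] with t ht
      exact hC z t (by linarith) ht
    · have : Tendsto (fun t : ℝ => Real.exp (-(z / 2) * t)) atTop (𝓝 0) :=
        Real.tendsto_exp_atBot.comp (tendsto_id.const_mul_atTop_of_neg (by linarith))
      simpa using this.const_mul C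

/-! ### The series ∑ wⁿ / Γ(n + b) -/

/-- The entire function `∑ wⁿ / Γ(n + b)`. -/
def gammaSeries (b w : ℂ) : ℂ := ∑' n : ℕ, w ^ n * (Complex.Gamma (n + b))⁻¹

theorem summable_norm_gammaSeries (b w : ℂ) :
    Summable fun n : ℕ => ‖w ^ n * (Complex.Gamma (n + b))⁻¹‖ := by
  -- With numerator parameter 1, the Pochhammer symbol (1)ₙ = n! cancels the factorial, so this is a
  -- regularized ₁F₁.
  have hr : (Complex.regularizedHGFunSeries {1} {b}).radius = ⊤ :=
    Complex.radius_regularizedHGFunSeries_eq_top (by simp)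
  have h := (Complex.regularizedHGFunSeries {1} {b}).summable_norm_apply (x := w) (by simp [hr])
  refine h.congr fun n => ?_
  have hn : ((n.factorial : ℕ) : ℂ) ≠ 0 := by exact_mod_cast n.factorial_ne_zero
  rw [Complex.regularizedHGFunSeries, FormalMultilinearSeries.ofScalars_apply_eq]
  simp only [Complex.regularizedHGFunCoeff, Multiset.map_singleton, Multiset.prod_singleton,
    ascPochhammer_eval_one, smul_eq_mul]
  congr 1
  rw [add_comm b]
  field_simp

theorem summable_gammaSeries (b w : ℂ) :
    Summable fun n : ℕ => w ^ n * (Complex.Gamma (n + b))⁻¹ :=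
  (summable_norm_gammaSeries b w).of_norm

theorem gammaSeries_sub_one (b w : ℂ) :
    gammaSeries (b - 1) w = (Complex.Gamma (b - 1))⁻¹ + w * gammaSeries b w := by
  rw [gammaSeries, (summable_gammaSeries _ _).tsum_eq_zero_add, gammaSeries, ← tsum_mul_left]
  congr 1
  · simp
  · refine tsum_congr fun n => ?_
    rw [pow_succ', mul_assoc]
    push_cast
    ring_nf

/-- Termwise, n/Γ(n + b) = 1/Γ(n + b - 1) - (b - 1)/Γ(n + b), which yields the first-order equation
of the series. -/
theorem exists_hasDerivAt_gammaSeries (b w : ℂ) :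
    ∃ d, HasDerivAt (gammaSeries b) d w ∧
      w * d = (Complex.Gamma (b - 1))⁻¹ + w * gammaSeries b w - (b - 1) * gammaSeries b w := by
  refine ⟨∑' n : ℕ, (n * w ^ (n - 1)) * (Complex.Gamma (n + b))⁻¹, ?_, ?_⟩
  · set R : ℝ := ‖w‖ + 1 with hR
    have hR1 : 1 ≤ R := by rw [hR]; linarith [norm_nonneg w]
    -- On the ball of radius R ≥ 1, n‖y‖ⁿ⁻¹ ≤ (2R)ⁿ, so the series at 2R is a majorant for the
    -- derivatives.
    refine hasDerivAt_tsum_of_isPreconnected (y₀ := 0)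
      (summable_norm_gammaSeries b ((2 * R : ℝ) : ℂ)) Metric.isOpen_ball
      (convex_ball (0 : ℂ) R).isPreconnected
      (fun n y _ => (hasDerivAt_pow n y).mul_const _) (fun n y hy => ?_)
      (Metric.mem_ball_self (by linarith)) (summable_gammaSeries b 0) (by simp [hR])
    rw [norm_mul, norm_mul, norm_mul]
    refine mul_le_mul_of_nonneg_right ?_ (norm_nonneg _)
    rw [norm_pow, norm_pow, Complex.norm_natCast, Complex.norm_real, Real.norm_eq_abs,
      abs_of_nonneg (by linarith), mul_pow]
    have hy' : ‖y‖ ≤ R := by simpa using (Metric.mem_ball.1 hy).le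
    have h2 : (n : ℝ) ≤ 2 ^ n := by exact_mod_cast (Nat.lt_two_pow_self).le
    refine mul_le_mul h2 ?_ (by positivity) (by positivity)
    calc ‖y‖ ^ (n - 1) ≤ R ^ (n - 1) := by gcongr
      _ ≤ R ^ n := pow_le_pow_right₀ hR1 (Nat.sub_le n 1)
  · rw [← gammaSeries_sub_one, gammaSeries, gammaSeries, ← tsum_mul_left, ← tsum_mul_left,
      ← (summable_gammaSeries _ _).tsum_sub ((summable_gammaSeries _ _).mul_left _)]
    refine tsum_congr fun n => ?_
    -- Valid at the poles too, as `Complex.Gamma` is 0 there and its inverse agrees with the entire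
    -- function 1/Γ; hence b is arbitrary.
    have h := Complex.one_div_Gamma_eq_self_mul_one_div_Gamma_add_one (n + (b - 1))
    rw [show (n : ℂ) + (b - 1) + 1 = n + b by ring] at h
    rw [h]
    rcases n with _ | n
    · simp
    · simp only [Nat.add_sub_cancel, pow_succ]
      ring

/-! ### Behaviour as z → 0⁺ and the closed form of the transform -/

theorem ofReal_mul_cpow {r : ℝ} (hr : 0 < r) {x : ℂ} (hx : x ≠ 0) (c : ℂ) :
    ((r : ℂ) * x) ^ c = (r : ℂ) ^ c * x ^ c := by
  have hr' : (r : ℂ) ≠ 0 := by exact_mod_cast hr.ne'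
  rw [Complex.cpow_def_of_ne_zero (mul_ne_zero hr' hx), Complex.cpow_def_of_ne_zero hr',
    Complex.cpow_def_of_ne_zero hx, Complex.log_ofReal_mul hr hx, ← Complex.exp_add,
    Complex.ofReal_log hr.le]
  ring_nf

/-- The substitution u = zt moves z out of the exponential, so that the limit z → 0⁺ can be taken
under the integral. -/
theorem cpow_mul_laplaceCpow {ε : ℂ} (hre : ε.re = 0) (s : ℂ) {z : ℝ} (hz : 0 < z) :
    (z : ℂ) ^ (1 - s) * laplaceCpow ε s z =
      ∫ u in Ioi (0 : ℝ), (Real.exp (-u) : ℂ) * (z + ε * u) ^ (-s) := by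
  have hz' : (z : ℂ) ≠ 0 := by exact_mod_cast hz.ne'
  have h := integral_comp_mul_left_Ioi
    (fun u : ℝ => (Real.exp (-u) : ℂ) * (z + ε * u) ^ (-s)) 0 hz
  rw [mul_zero, Complex.real_smul] at h
  have h2 : ∫ t in Ioi (0 : ℝ), (Real.exp (-(z * t)) : ℂ) * (z + ε * ((z * t : ℝ) : ℂ)) ^ (-s) =
      (z : ℂ) ^ (-s) * laplaceCpow ε s z := by
    rw [laplaceCpow, ← integral_const_mul]
    refine integral_congr_ae (.of_forall fun t => ?_)
    simp only [laplaceCpowKernel]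
    rw [show (z : ℂ) + ε * ((z * t : ℝ) : ℂ) = z * (1 + ε * t) by push_cast; ring,
      ofReal_mul_cpow hz (Complex.slitPlane_ne_zero (one_add_mul_mem_slitPlane hre t)), neg_mul]
    ring
  rw [h2] at h
  rw [show (1 : ℂ) - s = 1 + -s by ring, Complex.cpow_add _ _ hz', Complex.cpow_one, mul_assoc, h,
    Complex.ofReal_inv, mul_inv_cancel_left₀ hz']

/-- As Re s < 0, for 0 < z < 1 the power is at most (1 + u)^{-Re s} e^{π‖s‖}, so dominated
convergence applies; the limit is Euler's integral for Γ(1 - s). -/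
theorem tendsto_cpow_mul_laplaceCpow {ε : ℂ} (hre : ε.re = 0) (hε : ε ^ 2 = -1) {s : ℂ}
    (hs : s.re < 0) :
    Tendsto (fun z : ℝ => (z : ℂ) ^ (1 - s) * laplaceCpow ε s z) (𝓝[>] 0)
      (𝓝 (Complex.Gamma (1 - s) * ε ^ (-s))) := by
  have him : ε.im ≠ 0 := by
    intro h
    have : ε = 0 := Complex.ext hre h
    norm_num [this] at hε
  have hε0 : ε ≠ 0 := by rintro rfl; simp at him
  have hlim : Complex.Gamma (1 - s) * ε ^ (-s) =
      ∫ u in Ioi (0 : ℝ), (Real.exp (-u) : ℂ) * (ε * u) ^ (-s) := by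
    rw [Complex.Gamma_eq_integral (by simp; linarith), Complex.GammaIntegral, mul_comm,
      ← integral_const_mul]
    refine setIntegral_congr_fun measurableSet_Ioi fun u hu => ?_
    rw [mul_comm ε, ofReal_mul_cpow hu hε0, show (1 : ℂ) - s - 1 = -s by ring]
    ring
  rw [hlim]
  have hcont : ∀ z u : ℝ, 0 < u → (z + ε * u : ℂ) ∈ Complex.slitPlane := by
    intro z u hu
    exact Or.inr (by simp [him, hu.ne'])
  -- With δ = 1/2, half of the decay e^{-u} survives.
  obtain ⟨C, hC⟩ := exists_mul_log_one_add_le (M := -s.re) (δ := 1 / 2) (by linarith) (by norm_num)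
  have key : Tendsto (fun z : ℝ => ∫ u in Ioi (0 : ℝ), (Real.exp (-u) : ℂ) * (z + ε * u) ^ (-s))
      (𝓝[>] 0) (𝓝 (∫ u in Ioi (0 : ℝ), (Real.exp (-u) : ℂ) * (ε * u) ^ (-s))) := by
    refine tendsto_integral_filter_of_dominated_convergence
      (fun u => Real.exp (C + Real.pi * ‖s‖) * Real.exp (-(1 / 2) * u)) ?_ ?_
      (integrableOn_const_mul_exp_neg _ (by norm_num)) ?_
    · refine .of_forall fun z => ContinuousOn.aestronglyMeasurable (fun u hu => ?_)
        measurableSet_Ioi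
      refine ContinuousAt.continuousWithinAt (ContinuousAt.mul (by fun_prop) ?_)
      exact ContinuousAt.cpow (by fun_prop) (by fun_prop) (hcont z u hu)
    · filter_upwards [Ioo_mem_nhdsGT (zero_lt_one' ℝ)] with z hz
      filter_upwards [ae_restrict_mem measurableSet_Ioi] with u hu
      have hu : 0 < u := hu
      rw [norm_mul, Complex.norm_real, Real.norm_eq_abs, Real.abs_exp]
      have h1 : ‖(z + ε * u : ℂ)‖ ≤ 1 + u := by
        refine (norm_add_le _ _).trans ?_
        simp only [norm_mul, norm_eq_one_of_sq hε, Complex.norm_real, Real.norm_eq_abs, one_mul,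
          abs_of_pos hu, abs_of_pos hz.1]
        linarith [hz.2]
      have h2 : ‖(z + ε * u : ℂ) ^ (-s)‖ ≤ Real.exp (C + 1 / 2 * u + Real.pi * ‖s‖) := by
        refine (Complex.norm_cpow_le _ _).trans ?_
        rw [div_eq_mul_inv, ← Real.exp_neg, Real.exp_add]
        refine mul_le_mul ?_ (Real.exp_le_exp.2 ?_) (Real.exp_pos _).le (Real.exp_pos _).le
        · refine (Real.rpow_le_rpow (norm_nonneg _) h1 (by simp; linarith)).trans ?_
          rw [Real.rpow_def_of_pos (by linarith), mul_comm]
          exact Real.exp_le_exp.2 (hC u hu.le)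
        · refine (le_abs_self _).trans ?_
          rw [abs_neg, abs_mul]
          refine mul_le_mul (Complex.abs_arg_le_pi _) ?_ (abs_nonneg _) Real.pi_pos.le
          simpa using Complex.abs_im_le_norm s
      calc _ ≤ Real.exp (-u) * Real.exp (C + 1 / 2 * u + Real.pi * ‖s‖) := by gcongr
        _ = _ := by rw [← Real.exp_add, ← Real.exp_add]; ring_nf
    · filter_upwards [ae_restrict_mem measurableSet_Ioi] with u hu
      refine Tendsto.mono_left ?_ nhdsWithin_le_nhds
      have : ContinuousAt (fun z : ℝ => (Real.exp (-u) : ℂ) * (z + ε * u) ^ (-s)) 0 :=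
        ContinuousAt.mul (by fun_prop)
          (ContinuousAt.cpow (by fun_prop) (by fun_prop) (hcont 0 u hu))
      simpa [ContinuousAt] using this
  refine key.congr' ?_
  filter_upwards [self_mem_nhdsWithin] with z hz
  exact (cpow_mul_laplaceCpow hre s hz).symm

theorem laplaceCpow_eq_of_re_neg {ε : ℂ} (hre : ε.re = 0) (hε : ε ^ 2 = -1) {s : ℂ}
    (hs : s.re < 0) {z : ℝ} (hz : 0 < z) :
    laplaceCpow ε s z = Complex.Gamma (1 - s) * (ε * gammaSeries (2 - s) (-ε * z) +
      ε ^ (-s) * Complex.exp (-ε * z) * (z : ℂ) ^ (s - 1)) := by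
  have hΓ : Complex.Gamma (1 - s) ≠ 0 := Complex.Gamma_ne_zero_of_re_pos (by simp; linarith)
  set D : ℝ → ℂ := fun z => laplaceCpow ε s z -
    ε * Complex.Gamma (1 - s) * gammaSeries (2 - s) (-ε * z) with hD
  -- D removes the particular solution and satisfies D' = -(ε + (1 - s)/z) D; z^{1-s} e^{εz} is the
  -- integrating factor, so Q is constant.
  set Q : ℝ → ℂ := fun z => (z : ℂ) ^ (1 - s) * (Complex.exp (ε * z) * D z) with hQ
  have hs1 : (1 : ℂ) - s ≠ 0 := by
    intro h
    have := congrArg Complex.re h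
    simp at this
    linarith
  have hderiv : ∀ x ∈ Ioi (0 : ℝ), HasDerivAt Q 0 x := by
    intro x hx
    have hx0 : (x : ℂ) ≠ 0 := by exact_mod_cast (ne_of_gt hx)
    obtain ⟨d, hd, hd'⟩ := exists_hasDerivAt_gammaSeries (2 - s) (-ε * x)
    have h1 := hasDerivAt_laplaceCpow hre hε s hx
    have hlin : ∀ c : ℂ, HasDerivAt (fun x : ℝ => c * (x : ℂ)) (c * 1) x := fun c => by
      simpa using! (hasDerivAt_id x).ofReal_comp.const_mul c
    have h2 := (hd.comp x (hlin (-ε))).const_mul (ε * Complex.Gamma (1 - s))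
    have h3 : HasDerivAt (fun x : ℝ => (x : ℂ) ^ (1 - s)) _ x :=
      hasDerivAt_ofReal_cpow_const (ne_of_gt hx) hs1
    have h4 := h3.mul ((hlin ε).cexp.mul (h1.sub h2))
    refine h4.congr_deriv ?_
    have hrec := mul_laplaceCpow_sub_one hre hε s hx
    have hpow : (x : ℂ) ^ (1 - s) = x * (x : ℂ) ^ (1 - s - 1) := by
      conv_lhs => rw [show (1 : ℂ) - s = 1 + (1 - s - 1) by ring, Complex.cpow_add _ _ hx0,
        Complex.cpow_one]
    rw [show (2 : ℂ) - s - 1 = 1 - s by ring] at hd'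
    have hd'' : Complex.Gamma (1 - s) * (-ε * x * d) = 1 + Complex.Gamma (1 - s) *
        (-ε * x * gammaSeries (2 - s) (-ε * x) - (1 - s) * gammaSeries (2 - s) (-ε * x)) := by
      rw [hd']
      field_simp
      ring
    simp only [Function.comp, Pi.mul_apply, Pi.sub_apply]
    rw [hpow]
    linear_combination ((x : ℂ) ^ (1 - s - 1) * Complex.exp (ε * x)) * (ε * hrec - ε * hd''
      + (1 - s) * laplaceCpow ε s x * hε)
  have hconst : ∀ x ∈ Ioi (0 : ℝ), Q x = Q z := fun x hx =>
    isOpen_Ioi.is_const_of_deriv_eq_zero isPreconnected_Ioi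
      (fun y hy => (hderiv y hy).differentiableAt.differentiableWithinAt)
      (fun y hy => (hderiv y hy).deriv) hx hz
  have hlim : Tendsto Q (𝓝[>] 0) (𝓝 (Complex.Gamma (1 - s) * ε ^ (-s))) := by
    have h1 := tendsto_cpow_mul_laplaceCpow hre hε hs
    have hexp : Tendsto (fun z : ℝ => Complex.exp (ε * z)) (𝓝[>] 0) (𝓝 1) := by
      have : Continuous fun z : ℝ => Complex.exp (ε * z) := by fun_prop
      simpa using this.continuousWithinAt.tendsto (x := (0 : ℝ)) (s := Ioi 0)
    have hser : Tendsto (fun z : ℝ => gammaSeries (2 - s) (-ε * z)) (𝓝[>] 0)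
        (𝓝 (gammaSeries (2 - s) 0)) := by
      obtain ⟨d, hd, -⟩ := exists_hasDerivAt_gammaSeries (2 - s) 0
      have h0 : Tendsto (fun z : ℝ => -ε * (z : ℂ)) (𝓝[>] 0) (𝓝 0) := by
        have : Continuous fun z : ℝ => -ε * (z : ℂ) := by fun_prop
        simpa using this.continuousWithinAt.tendsto (x := (0 : ℝ)) (s := Ioi 0)
      exact hd.continuousAt.tendsto.comp h0
    have hpow : Tendsto (fun z : ℝ => (z : ℂ) ^ (1 - s)) (𝓝[>] 0) (𝓝 0) := by
      have hc : ContinuousAt (fun z : ℝ => (z : ℂ) ^ (1 - s)) 0 :=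
        Complex.continuousAt_ofReal_cpow_const 0 (1 - s) (Or.inl (by simp; linarith))
      have := hc.continuousWithinAt.tendsto (s := Ioi 0)
      simpa [Complex.zero_cpow hs1] using this
    have h2 := hexp.mul (h1.sub ((hpow.mul hser).const_mul (ε * Complex.Gamma (1 - s))))
    simp only [zero_mul, mul_zero, sub_zero, one_mul] at h2
    refine h2.congr fun x => ?_
    simp only [hQ, hD]
    ring
  have hQz : Q z = Complex.Gamma (1 - s) * ε ^ (-s) := by
    refine tendsto_nhds_unique (tendsto_const_nhds.congr' ?_) hlim
    filter_upwards [self_mem_nhdsWithin] with x hx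
    exact (hconst x hx).symm
  have hz0 : (z : ℂ) ≠ 0 := by exact_mod_cast hz.ne'
  have hpow : (z : ℂ) ^ (1 - s) * (z : ℂ) ^ (s - 1) = 1 := by
    rw [← Complex.cpow_add _ _ hz0]; simp
  have hexp : Complex.exp (ε * z) * Complex.exp (-ε * z) = 1 := by
    rw [← Complex.exp_add]; simp
  have hDz : D z = Complex.Gamma (1 - s) * ε ^ (-s) * Complex.exp (-ε * z) *
      (z : ℂ) ^ (s - 1) := by
    rw [← hQz]
    simp only [hQ]
    linear_combination (-D z * Complex.exp (ε * z) * Complex.exp (-ε * z)) * hpow - D z * hexp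
  simp only [hD] at hDz
  linear_combination hDz

/-- Both sides obey the recurrence linking s - 1 to s, so the formula spreads from Re s < 0 one unit
strip at a time. -/
theorem laplaceCpow_eq {ε : ℂ} (hre : ε.re = 0) (hε : ε ^ 2 = -1) {z : ℝ} (hz : 0 < z) {s : ℂ}
    (hs : ∀ n : ℕ, s ≠ n + 1) :
    laplaceCpow ε s z = Complex.Gamma (1 - s) * (ε * gammaSeries (2 - s) (-ε * z) +
      ε ^ (-s) * Complex.exp (-ε * z) * (z : ℂ) ^ (s - 1)) := by
  have hε0 : ε ≠ 0 := by rintro rfl; norm_num at hε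
  have hz0 : (z : ℂ) ≠ 0 := by exact_mod_cast hz.ne'
  have key : ∀ n : ℕ, ∀ s : ℂ, (∀ n : ℕ, s ≠ n + 1) → s.re < n →
      laplaceCpow ε s z = Complex.Gamma (1 - s) * (ε * gammaSeries (2 - s) (-ε * z) +
        ε ^ (-s) * Complex.exp (-ε * z) * (z : ℂ) ^ (s - 1)) := by
    intro n
    induction n with
    | zero => exact fun s _ hs => laplaceCpow_eq_of_re_neg hre hε (by simpa using hs) hz
    | succ n ih =>
      intro s hs hsn
      have h := ih (s - 1) (fun m hm => hs (m + 1) (by push_cast; linear_combination hm))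
        (by push_cast at hsn; simp; linarith)
      have hs1 : (1 : ℂ) - s ≠ 0 := fun h => hs 0 (by push_cast; linear_combination -h)
      have hΓ : Complex.Gamma (1 - s) ≠ 0 := Complex.Gamma_ne_zero fun m hm =>
        hs m (by linear_combination -hm)
      have hG := Complex.Gamma_add_one (1 - s) hs1
      have hrec := mul_laplaceCpow_sub_one hre hε s hz
      have hser := gammaSeries_sub_one (3 - s) (-ε * z)
      have hε1 : ε ^ (-(s - 1)) = ε ^ (-s) * ε := by
        rw [show -(s - 1) = -s + 1 by ring, Complex.cpow_add _ _ hε0, Complex.cpow_one]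
      have hz1 : (z : ℂ) * (z : ℂ) ^ (s - 1 - 1) = (z : ℂ) ^ (s - 1) := by
        conv_rhs => rw [show s - 1 = 1 + (s - 1 - 1) by ring, Complex.cpow_add _ _ hz0,
          Complex.cpow_one]
      rw [show (1 : ℂ) - s + 1 = 2 - s by ring] at hG
      rw [show (3 : ℂ) - s - 1 = 2 - s by ring, hG] at hser
      rw [show (1 : ℂ) - (s - 1) = 2 - s by ring, show (2 : ℂ) - (s - 1) = 3 - s by ring, hG,
        hε1] at h
      have hser' : (1 - s) * Complex.Gamma (1 - s) * gammaSeries (2 - s) (-ε * z) = 1 +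
          (1 - s) * Complex.Gamma (1 - s) * (-ε * z * gammaSeries (3 - s) (-ε * z)) := by
        rw [hser]
        field_simp
      refine mul_left_cancel₀ (mul_ne_zero hε0 hs1) ?_
      linear_combination -hrec + z * h + hser' + (1 - s) * Complex.Gamma (1 - s) *
        (ε ^ (-s) * ε * Complex.exp (-ε * z)) * hz1 - (1 - s) * Complex.Gamma (1 - s) *
        gammaSeries (2 - s) (-ε * z) * hε
  obtain ⟨n, hn⟩ := exists_nat_gt s.re
  exact key n s hs hn

/-! ### J_{±1/2} and the ₁F₂ by the duplication formula -/

theorem ofReal_sqrt_pi_ne_zero : ((√Real.pi : ℝ) : ℂ) ≠ 0 := by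
  exact_mod_cast (Real.sqrt_pos.2 Real.pi_pos).ne'

theorem two_cpow_neg_natCast (n : ℕ) : (2 : ℂ) ^ (-(n : ℂ)) = (2 ^ n)⁻¹ := by
  rw [Complex.cpow_neg, Complex.cpow_natCast]

/-- Duplication turns m! Γ(m + 1/2) into (2m)! up to √π and a power of 2, leaving the cosine series.
-/
theorem besselJ_neg_half {z : ℂ} :
    besselJ (-(1 / 2)) z = (z / 2) ^ (-(1 / 2) : ℂ) / (√Real.pi : ℝ) * Complex.cos z := by
  rw [besselJ, Complex.cos_eq_tsum, div_mul_eq_mul_div, mul_div_assoc, ← tsum_div_const]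
  congr 1
  refine tsum_congr fun m => ?_
  have h := Complex.Gamma_mul_Gamma_add_half ((m : ℂ) + 1 / 2)
  rw [show (m : ℂ) + 1 / 2 + 1 / 2 = m + 1 by ring, Complex.Gamma_nat_eq_factorial,
    show 2 * ((m : ℂ) + 1 / 2) = ((2 * m : ℕ) : ℂ) + 1 by push_cast; ring,
    Complex.Gamma_nat_eq_factorial, show 1 - (((2 * m : ℕ) : ℂ) + 1) = -((2 * m : ℕ) : ℂ) by ring,
    two_cpow_neg_natCast] at h
  rw [show -(1 / 2) + (m : ℂ) + 1 = m + 1 / 2 by ring, mul_comm (m.factorial : ℂ), h]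
  have h1 := ofReal_sqrt_pi_ne_zero
  have h2 : ((2 * m).factorial : ℂ) ≠ 0 := by exact_mod_cast (2 * m).factorial_ne_zero
  rw [div_pow]
  field_simp

theorem besselJ_half {z : ℂ} (hz : z ≠ 0) :
    besselJ (1 / 2) z = (z / 2) ^ (-(1 / 2) : ℂ) / (√Real.pi : ℝ) * Complex.sin z := by
  have hz2 : z / 2 ≠ 0 := by simpa using hz
  have hpow : (z / 2) ^ (1 / 2 : ℂ) = (z / 2) ^ (-(1 / 2) : ℂ) * (z / 2) := by
    rw [show (1 / 2 : ℂ) = -(1 / 2) + 1 by norm_num, Complex.cpow_add _ _ hz2, Complex.cpow_one]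
    norm_num
  rw [besselJ, Complex.sin_eq_tsum, hpow, div_mul_eq_mul_div, mul_div_assoc, mul_assoc,
    ← tsum_div_const, ← tsum_mul_left]
  congr 1
  refine tsum_congr fun m => ?_
  have h := Complex.Gamma_mul_Gamma_add_half ((m : ℂ) + 1)
  rw [Complex.Gamma_nat_eq_factorial,
    show 2 * ((m : ℂ) + 1) = ((2 * m + 1 : ℕ) : ℂ) + 1 by push_cast; ring,
    Complex.Gamma_nat_eq_factorial,
    show 1 - (((2 * m + 1 : ℕ) : ℂ) + 1) = -((2 * m + 1 : ℕ) : ℂ) by ring,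
    two_cpow_neg_natCast] at h
  rw [show 1 / 2 + (m : ℂ) + 1 = m + 1 + 1 / 2 by ring, h]
  have h1 := ofReal_sqrt_pi_ne_zero
  have h2 : ((2 * m + 1).factorial : ℂ) ≠ 0 := by exact_mod_cast (2 * m + 1).factorial_ne_zero
  rw [div_pow]
  field_simp
  ring

theorem gammaSeries_I_add_neg_I (b z : ℂ) :
    gammaSeries b (Complex.I * z) + gammaSeries b (-Complex.I * z) =
      2 * ∑' n : ℕ, (-(z ^ 2)) ^ n * (Complex.Gamma (2 * n + b))⁻¹ := by
  rw [gammaSeries, gammaSeries, ← (summable_gammaSeries _ _).tsum_add (summable_gammaSeries _ _),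
    ← tsum_mul_left]
  have hinj : Function.Injective fun n : ℕ => 2 * n := fun m n h => by simpa using h
  rw [← hinj.tsum_eq]
  · refine tsum_congr fun n => ?_
    rw [pow_mul, pow_mul, show (Complex.I * z) ^ 2 = -z ^ 2 by rw [mul_pow]; simp,
      show (-Complex.I * z) ^ 2 = -z ^ 2 by rw [mul_pow]; simp]
    push_cast
    ring
  · intro n hn
    by_contra h
    have hodd : Odd n := by
      rw [← Nat.not_even_iff_odd]
      rintro ⟨k, rfl⟩
      exact h ⟨k, by ring⟩
    refine hn ?_
    simp only [neg_mul, hodd.neg_pow]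
    ring

/-- The lower parameters differ by 1/2, so duplication merges their two Gamma factors into Γ(2n +
2b). -/
theorem hypergeometric1F2_one_add_half (b z : ℂ) :
    hypergeometric1F2 1 b (b + 1 / 2) (-(z ^ 2 / 4)) =
      Complex.Gamma (2 * b) * ∑' n : ℕ, (-(z ^ 2)) ^ n * (Complex.Gamma (2 * n + 2 * b))⁻¹ := by
  have h1 := ofReal_sqrt_pi_ne_zero
  rw [hypergeometric1F2, Complex.Gamma_mul_Gamma_add_half, Complex.regularizedHGFun,
    FormalMultilinearSeries.sum, mul_assoc, mul_assoc, ← tsum_mul_left, ← tsum_mul_left]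
  congr 1
  refine tsum_congr fun n => ?_
  have hn : ((n.factorial : ℕ) : ℂ) ≠ 0 := by exact_mod_cast n.factorial_ne_zero
  rw [Complex.regularizedHGFunSeries, FormalMultilinearSeries.ofScalars_apply_eq]
  simp only [Complex.regularizedHGFunCoeff, Multiset.map_singleton, Multiset.prod_singleton,
    ascPochhammer_eval_one, smul_eq_mul, Multiset.insert_eq_cons, Multiset.map_cons,
    Multiset.prod_cons]
  rw [show b + 1 / 2 + (n : ℂ) = b + n + 1 / 2 by ring, Complex.Gamma_mul_Gamma_add_half,
    show 1 - 2 * (b + (n : ℂ)) = 1 - 2 * b + -((2 * n : ℕ) : ℂ) by push_cast; ring,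
    Complex.cpow_add _ _ two_ne_zero, two_cpow_neg_natCast,
    show 2 * (b + (n : ℂ)) = 2 * n + 2 * b by ring]
  have h2 : (2 : ℂ) ^ (1 - 2 * b) ≠ 0 := by simp [Complex.cpow_eq_zero_iff]
  rw [show -(z ^ 2 / 4) = -(z ^ 2) / 4 by ring, div_pow, pow_mul,
    show (2 : ℂ) ^ 2 = 4 by norm_num]
  field_simp

/-! ### The sine transform and the Lommel formula off the exceptional points -/

/-- The Laplace transform of `t ↦ sin (s arctan t) / (1 + t ^ 2) ^ (s / 2)`. -/
def laplaceSinArctan (s : ℂ) (z : ℝ) : ℂ :=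
  (laplaceCpow (-Complex.I) s z - laplaceCpow Complex.I s z) / (2 * Complex.I)

theorem differentiable_laplaceSinArctan {z : ℝ} (hz : 0 < z) :
    Differentiable ℂ fun s => laplaceSinArctan s z :=
  ((differentiable_laplaceCpow (by simp) (by simp) hz).sub
    (differentiable_laplaceCpow (by simp) (by simp) hz)).div_const _

theorem laplaceSinArctan_zero (z : ℝ) : laplaceSinArctan 0 z = 0 := by
  simp [laplaceSinArctan, laplaceCpow, laplaceCpowKernel]

theorem laplaceSinArctan_eq {z : ℝ} (hz : 0 < z) {s : ℂ} (hs : ∀ n : ℕ, s ≠ n) :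
    laplaceSinArctan s z = Complex.Gamma (1 - s) *
      (-(∑' n : ℕ, (-((z : ℂ) ^ 2)) ^ n * (Complex.Gamma (2 * n + (2 - s)))⁻¹) +
        Complex.sin (z + Real.pi * s / 2) * (z : ℂ) ^ (s - 1)) := by
  have hs' : ∀ n : ℕ, s ≠ n + 1 := fun n => by exact_mod_cast hs (n + 1)
  have h := gammaSeries_I_add_neg_I (2 - s) z
  rw [laplaceSinArctan, laplaceCpow_eq (by simp) (by simp) hz hs',
    laplaceCpow_eq (by simp) (by simp) hz hs', neg_neg, Complex.sin,
    -- The principal values (±i)^{-s} = e^{∓iπs/2} supply the phase πs/2 of the sine.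
    Complex.cpow_def_of_ne_zero Complex.I_ne_zero,
    Complex.cpow_def_of_ne_zero (neg_ne_zero.2 Complex.I_ne_zero), Complex.log_I,
    Complex.log_neg_I, ← Complex.exp_add, ← Complex.exp_add]
  rw [show -(Real.pi / 2 : ℂ) * Complex.I * -s + Complex.I * z =
      (z + Real.pi * s / 2) * Complex.I by ring,
    show (Real.pi / 2 : ℂ) * Complex.I * -s + -Complex.I * z =
      -(z + Real.pi * s / 2) * Complex.I by ring, div_eq_iff (by simp)]
  linear_combination (-Complex.I * Complex.Gamma (1 - s)) * h +
    (Complex.Gamma (1 - s) * (z : ℂ) ^ (s - 1)) *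
    (Complex.exp ((z + Real.pi * s / 2) * Complex.I) -
      Complex.exp (-(z + Real.pi * s / 2) * Complex.I)) * Complex.I_sq

/-- The factor s turns the Γ(-s) common to both parts of the Lommel function into -Γ(1 - s). The
Bessel part collapses to sin(z + πs/2) by the addition theorem. -/
theorem mul_lommelFormula {z : ℝ} (hz : 0 < z) {s : ℂ} (hs : ∀ n : ℕ, s ≠ n) :
    s * lommelFormula (-s - 1 / 2) (1 / 2) z = (z : ℂ) ^ (1 / 2 - s) * laplaceSinArctan s z := by
  have hz0 : (z : ℂ) ≠ 0 := by exact_mod_cast hz.ne'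
  have hs0 : s ≠ 0 := by exact_mod_cast hs 0
  have hs1 : (1 : ℂ) - s ≠ 0 := fun h => hs 1 (by push_cast; linear_combination -h)
  have hint : ¬ ∃ n : ℤ, (1 / 2 : ℂ) = n := by
    rintro ⟨n, hn⟩
    have h2 : ((2 * n : ℤ) : ℂ) = ((1 : ℤ) : ℂ) := by push_cast; rw [← hn]; norm_num
    have h3 : 2 * n = 1 := by exact_mod_cast h2
    omega
  have hΓ1 : Complex.Gamma (1 - s) = -s * Complex.Gamma (-s) := by
    rw [← Complex.Gamma_add_one _ (neg_ne_zero.2 hs0)]; ring_nf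
  have hΓ2 : Complex.Gamma (2 - s) = (1 - s) * Complex.Gamma (1 - s) := by
    rw [← Complex.Gamma_add_one _ hs1]; ring_nf
  have hsmall : smallLommel (-s - 1 / 2) (1 / 2) z = (z : ℂ) ^ (1 / 2 - s) * Complex.Gamma (-s) *
      ∑' n : ℕ, (-((z : ℂ) ^ 2)) ^ n * (Complex.Gamma (2 * n + (2 - s)))⁻¹ := by
    have h := hypergeometric1F2_one_add_half (1 - s / 2) z
    rw [show 2 * (1 - s / 2) = 2 - s by ring] at h
    rw [smallLommel, show (-s - 1 / 2) / 2 - 1 / 2 / 2 + 3 / 2 = 1 - s / 2 by ring,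
      show (-s - 1 / 2) / 2 + 1 / 2 / 2 + 3 / 2 = 1 - s / 2 + 1 / 2 by ring, h, hΓ2, hΓ1,
      show -s - 1 / 2 + 1 = 1 / 2 - s by ring, show -s - 1 / 2 - 1 / 2 + 1 = -s by ring,
      show -s - 1 / 2 + 1 / 2 + 1 = 1 - s by ring]
    field_simp
  have hdup : Complex.Gamma ((-s - 1 / 2 - 1 / 2 + 1) / 2) *
      Complex.Gamma ((-s - 1 / 2 + 1 / 2 + 1) / 2) =
      Complex.Gamma (-s) * 2 ^ (1 + s) * (√Real.pi : ℝ) := by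
    have h := Complex.Gamma_mul_Gamma_add_half (-s / 2)
    rw [show 2 * (-s / 2) = -s by ring, show 1 - -s = 1 + s by ring] at h
    rw [← h]
    ring_nf
  have h2pow : (2 : ℂ) ^ (-s - 1 / 2 - 1) * 2 ^ (1 + s) * ((z : ℂ) / 2) ^ (-(1 / 2) : ℂ) =
      (z : ℂ) ^ (-(1 / 2) : ℂ) := by
    have h := ofReal_mul_cpow two_pos (x := (z : ℂ) / 2) (by simpa using hz0) (-(1 / 2))
    rw [← Complex.cpow_add _ _ two_ne_zero,
      show -s - 1 / 2 - 1 + (1 + s) = -(1 / 2) by ring]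
    push_cast at h
    rw [← h]
    congr 1
    ring
  have hcos1 : Complex.cos ((-s - 1 / 2 - 1 / 2) * Real.pi / 2) =
      -Complex.sin (Real.pi * s / 2) := by
    rw [show (-s - 1 / 2 - 1 / 2) * (Real.pi : ℂ) / 2 = -(Real.pi * s / 2 + Real.pi / 2) by ring,
      Complex.cos_neg, Complex.cos_add_pi_div_two]
  have hcos2 : Complex.cos ((-s - 1 / 2 + 1 / 2) * Real.pi / 2) =
      Complex.cos (Real.pi * s / 2) := by
    rw [show (-s - 1 / 2 + 1 / 2) * (Real.pi : ℂ) / 2 = -(Real.pi * s / 2) by ring,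
      Complex.cos_neg]
  have hsin : Complex.sin (1 / 2 * Real.pi) = 1 := by
    rw [show (1 / 2 : ℂ) * Real.pi = Real.pi / 2 by ring, Complex.sin_pi_div_two]
  have hzpow : (z : ℂ) ^ (1 / 2 - s) * (z : ℂ) ^ (s - 1) = (z : ℂ) ^ (-(1 / 2) : ℂ) := by
    rw [← Complex.cpow_add _ _ hz0]
    congr 1
    ring
  have hpi := ofReal_sqrt_pi_ne_zero
  have hmain : 2 ^ (-s - 1 / 2 - 1) * Complex.Gamma ((-s - 1 / 2 - 1 / 2 + 1) / 2) *
      Complex.Gamma ((-s - 1 / 2 + 1 / 2 + 1) / 2) * (-Complex.sin (Real.pi * s / 2) *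
        (((z : ℂ) / 2) ^ (-(1 / 2) : ℂ) / (√Real.pi : ℝ) * Complex.cos z) -
        Complex.cos (Real.pi * s / 2) *
        (((z : ℂ) / 2) ^ (-(1 / 2) : ℂ) / (√Real.pi : ℝ) * Complex.sin z)) =
      -(z : ℂ) ^ (-(1 / 2) : ℂ) * Complex.Gamma (-s) * Complex.sin (z + Real.pi * s / 2) := by
    rw [mul_assoc _ (Complex.Gamma _) (Complex.Gamma _), hdup, ← h2pow, Complex.sin_add]
    field_simp
    ring
  rw [lommelFormula, if_neg hint, hsin, div_one, besselJ_half hz0, besselJ_neg_half, hcos1, hcos2,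
    hmain, hsmall, laplaceSinArctan_eq hz hs, hΓ1, ← hzpow]
  ring

/-! ### Reduction of the given integral to the transform -/

theorem log_one_add_mul_I (t : ℝ) :
    Complex.log (1 + Complex.I * t) =
      (Real.log (1 + t ^ 2) : ℝ) / 2 + Complex.I * (Real.arctan t : ℝ) := by
  have hnorm : ‖1 + Complex.I * t‖ = √(1 + t ^ 2) := by
    rw [Complex.norm_def, Complex.normSq_apply]
    simp
    ring_nf
  -- The real part is 1, so the argument is arcsin(t/√(1 + t²)), which is arctan t.
  rw [Complex.log, hnorm, Real.log_sqrt (by positivity),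
    Complex.arg_of_re_nonneg (by simp), hnorm, Real.arctan_eq_arcsin]
  simp
  ring

theorem log_one_add_mul_neg_I (t : ℝ) :
    Complex.log (1 + -Complex.I * t) =
      (Real.log (1 + t ^ 2) : ℝ) / 2 - Complex.I * (Real.arctan t : ℝ) := by
  have h := log_one_add_mul_I (-t)
  rw [Real.arctan_neg, neg_sq] at h
  push_cast at h ⊢
  rw [show (1 : ℂ) + -Complex.I * t = 1 + Complex.I * -t by ring, h]
  ring

theorem integrand_comp_mul {a : ℝ} (ha : 0 < a) (p t : ℝ) (s : ℂ) :
    (Real.exp (-p * (a * t)) : ℂ) * Complex.sin (s * (Real.arctan (a * t / a) : ℂ)) /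
        ((a ^ 2 + (a * t) ^ 2 : ℝ) : ℂ) ^ (s / 2) =
      (a : ℂ) ^ (-s) * ((laplaceCpowKernel (-Complex.I) s (p * a) t -
        laplaceCpowKernel Complex.I s (p * a) t) / (2 * Complex.I)) := by
  have hpos : 0 < 1 + t ^ 2 := by positivity
  have ha0 : (a : ℂ) ≠ 0 := by exact_mod_cast ha.ne'
  rw [laplaceCpowKernel, laplaceCpowKernel,
    Complex.cpow_def_of_ne_zero (Complex.slitPlane_ne_zero
      (one_add_mul_mem_slitPlane Complex.I_re t)),
    Complex.cpow_def_of_ne_zero (Complex.slitPlane_ne_zero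
      (one_add_mul_mem_slitPlane (by simp) t)), log_one_add_mul_I, log_one_add_mul_neg_I,
    mul_div_cancel_left₀ _ ha.ne', show a ^ 2 + (a * t) ^ 2 = a ^ 2 * (1 + t ^ 2) by ring,
    Complex.cpow_def_of_ne_zero (x := ((a ^ 2 * (1 + t ^ 2) : ℝ) : ℂ))
      (by exact_mod_cast (by positivity : a ^ 2 * (1 + t ^ 2) ≠ 0)),
    ← Complex.ofReal_log (by positivity), Real.log_mul (by positivity) hpos.ne', Real.log_pow,
    Complex.cpow_def_of_ne_zero ha0, ← Complex.ofReal_log ha.le, Complex.sin,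
    div_eq_mul_inv _ (Complex.exp _), ← Complex.exp_neg,
    show -p * (a * t) = -(p * a) * t by ring]
  set A : ℂ := ((Real.log a : ℝ) : ℂ)
  set B : ℂ := ((Real.log (1 + t ^ 2) : ℝ) : ℂ) with hB
  set θ : ℂ := ((Real.arctan t : ℝ) : ℂ)
  have e1 : Complex.exp ((B / 2 - Complex.I * θ) * -s) =
      Complex.exp (-B * s / 2) * Complex.exp (s * θ * Complex.I) := by
    rw [← Complex.exp_add]; ring_nf
  have e2 : Complex.exp ((B / 2 + Complex.I * θ) * -s) =
      Complex.exp (-B * s / 2) * Complex.exp (-(s * θ) * Complex.I) := by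
    rw [← Complex.exp_add]; ring_nf
  have e3 : Complex.exp (-((((2 : ℕ) * Real.log a + Real.log (1 + t ^ 2) : ℝ) : ℂ) * (s / 2))) =
      Complex.exp (A * -s) * Complex.exp (-B * s / 2) := by
    rw [← Complex.exp_add, Complex.ofReal_add, Complex.ofReal_mul, ← hB]
    congr 1
    simp only [A]
    push_cast
    ring
  rw [e1, e2, e3]
  have hI := Complex.I_ne_zero
  field_simp
  linear_combination (Complex.exp (s * θ * Complex.I) - Complex.exp (-(s * θ * Complex.I))) *
    (-1) * Complex.I_sq

theorem integrableOn_integrand {a p : ℝ} (ha : 0 < a) (hp : 0 < p) (s : ℂ) :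
    IntegrableOn (fun x : ℝ => (Real.exp (-p * x) : ℂ) *
        Complex.sin (s * (Real.arctan (x / a) : ℂ)) / ((a ^ 2 + x ^ 2 : ℝ) : ℂ) ^ (s / 2))
      (Ioi 0) := by
  have h := integrableOn_Ioi_comp_mul_left_iff (fun x : ℝ => (Real.exp (-p * x) : ℂ) *
        Complex.sin (s * (Real.arctan (x / a) : ℂ)) / ((a ^ 2 + x ^ 2 : ℝ) : ℂ) ^ (s / 2)) 0 ha
  rw [mul_zero] at h
  refine h.1 ?_
  simp only [integrand_comp_mul ha]
  exact (((integrableOn_laplaceCpowKernel (by simp) (by simp) s (mul_pos hp ha)).sub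
    (integrableOn_laplaceCpowKernel (by simp) (by simp) s (mul_pos hp ha))).div_const _).const_mul _

theorem integral_integrand {a p : ℝ} (ha : 0 < a) (hp : 0 < p) (s : ℂ) :
    ∫ x in Ioi (0 : ℝ), (Real.exp (-p * x) : ℂ) *
        Complex.sin (s * (Real.arctan (x / a) : ℂ)) / ((a ^ 2 + x ^ 2 : ℝ) : ℂ) ^ (s / 2) =
      (a : ℂ) ^ (1 - s) * laplaceSinArctan s (p * a) := by
  have h := integral_comp_mul_left_Ioi' (fun x : ℝ => (Real.exp (-p * x) : ℂ) *
        Complex.sin (s * (Real.arctan (x / a) : ℂ)) / ((a ^ 2 + x ^ 2 : ℝ) : ℂ) ^ (s / 2)) 0 ha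
  have ha0 : (a : ℂ) ≠ 0 := by exact_mod_cast ha.ne'
  rw [mul_zero] at h
  rw [← h]
  simp only [integrand_comp_mul ha]
  rw [integral_const_mul, integral_div,
    integral_sub (integrableOn_laplaceCpowKernel (by simp) (by simp) s (mul_pos hp ha))
      (integrableOn_laplaceCpowKernel (by simp) (by simp) s (mul_pos hp ha)), Complex.real_smul,
    show (1 : ℂ) - s = 1 + -s by ring, Complex.cpow_add _ _ ha0, Complex.cpow_one, mul_assoc]
  rfl

/-! ### Continuation in s and the exceptional points -/

/-- The analytic continuation in `s` of `S_{-s-1/2, 1/2}(z)`. -/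
def lommelHalf (s : ℂ) (z : ℝ) : ℂ :=
  (z : ℂ) ^ (1 / 2 - s) * dslope (fun s => laplaceSinArctan s z) 0 s

/-- At s = 0 both sides vanish because the transform does; the divided difference gives the rest. -/
theorem mul_lommelHalf (s : ℂ) (z : ℝ) :
    s * lommelHalf s z = (z : ℂ) ^ (1 / 2 - s) * laplaceSinArctan s z := by
  have h := sub_smul_dslope (fun s => laplaceSinArctan s z) 0 s
  rw [laplaceSinArctan_zero, sub_zero, sub_zero, smul_eq_mul] at h
  rw [lommelHalf, mul_left_comm, h]

theorem continuous_lommelHalf {z : ℝ} (hz : 0 < z) : Continuous fun s => lommelHalf s z := by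
  have hz0 : (z : ℂ) ≠ 0 := by exact_mod_cast hz.ne'
  have hd := differentiable_laplaceSinArctan hz
  have h1 : Continuous (dslope (fun s => laplaceSinArctan s z) 0) := by
    refine continuous_iff_continuousAt.2 fun s => ?_
    rcases eq_or_ne s 0 with rfl | hs
    · exact continuousAt_dslope_same.2 (hd 0)
    · exact (continuousAt_dslope_of_ne hs).2 (hd s).continuousAt
  have h2 : Continuous fun s : ℂ => (z : ℂ) ^ (1 / 2 - s) :=
    Continuous.const_cpow (by fun_prop) (Or.inl hz0)
  exact h2.mul h1

theorem lommelFormula_half_eq {z : ℝ} (hz : 0 < z) {s : ℂ} (hs : ∀ n : ℕ, s ≠ n) :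
    lommelFormula (-s - 1 / 2) (1 / 2) z = lommelHalf s z := by
  have hs0 : s ≠ 0 := by exact_mod_cast hs 0
  exact mul_left_cancel₀ hs0 ((mul_lommelFormula hz hs).trans (mul_lommelHalf s z).symm)

theorem lommelExceptional_half_iff (s : ℂ) :
    LommelExceptional (-s - 1 / 2) (1 / 2) ↔ ∃ n : ℕ, s = n := by
  constructor
  · rintro ⟨n, h | h⟩
    · exact ⟨2 * n + 1, by push_cast; linear_combination -h⟩
    · exact ⟨2 * n, by push_cast; linear_combination -h⟩
  · rintro ⟨n, rfl⟩
    rcases Nat.even_or_odd' n with ⟨m, rfl | rfl⟩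
    · exact ⟨m, Or.inr (by push_cast; ring)⟩
    · exact ⟨m, Or.inl (by push_cast; ring)⟩

/-- Exceptional indices are spaced by integers, so a punctured unit ball about one contains no
other; there the explicit formula equals a continuous function. -/
theorem tendsto_lommelFormula_half {z : ℝ} (hz : 0 < z) (n : ℕ) :
    Tendsto (fun μ : ℂ => lommelFormula μ (1 / 2) z) (𝓝[≠] (-(n : ℂ) - 1 / 2))
      (𝓝 (lommelHalf n z)) := by
  have hc : Continuous fun μ : ℂ => lommelHalf (-μ - 1 / 2) z :=
    (continuous_lommelHalf hz).comp (by fun_prop : Continuous fun μ : ℂ => -μ - 1 / 2)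
  have h := hc.continuousAt.tendsto (x := -(n : ℂ) - 1 / 2)
  rw [show -(-(n : ℂ) - 1 / 2) - 1 / 2 = n by ring] at h
  refine (h.mono_left nhdsWithin_le_nhds).congr' ?_
  filter_upwards [self_mem_nhdsWithin,
    nhdsWithin_le_nhds (Metric.ball_mem_nhds (-(n : ℂ) - 1 / 2) one_pos)] with μ hμ hμ1
  rw [← lommelFormula_half_eq hz, show -(-μ - 1 / 2) - 1 / 2 = μ by ring]
  intro m hm
  have hμ' : μ = -(m : ℂ) - 1 / 2 := by linear_combination -hm
  rw [hμ', Metric.mem_ball, dist_eq_norm, show -(m : ℂ) - 1 / 2 - (-(n : ℂ) - 1 / 2) =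
    ((n - m : ℤ) : ℂ) by push_cast; ring, Complex.norm_intCast] at hμ1
  have hnm : |(n - m : ℤ)| < 1 := by exact_mod_cast hμ1
  rw [Int.abs_lt_one_iff] at hnm
  have : n = m := by omega
  exact hμ (by rw [hμ', this]; rfl)

theorem lommelS_half_eq {z : ℝ} (hz : 0 < z) (s : ℂ) :
    lommelS (-s - 1 / 2) (1 / 2) z = lommelHalf s z := by
  rw [lommelS]
  split_ifs with h
  · obtain ⟨n, rfl⟩ := (lommelExceptional_half_iff s).1 h
    exact (tendsto_lommelFormula_half hz n).limUnder_eq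
  · rw [lommelExceptional_half_iff] at h
    exact lommelFormula_half_eq hz fun n hn => h ⟨n, hn⟩

end

theorem lemma2p1 (k : ℕ) (hk : 1 ≤ k) (a : ℝ) (ha : 0 < a) (s : ℂ) :
    -- where `S` is defined by a limit, that limit exists
    (LommelExceptional (-s - 1 / 2) (1 / 2) →
      Tendsto (fun μ : ℂ => lommelFormula μ (1 / 2) ((2 * Real.pi * a * k : ℝ) : ℂ))
        (𝓝[≠] (-s - 1 / 2))
        (𝓝 (lommelS (-s - 1 / 2) (1 / 2) ((2 * Real.pi * a * k : ℝ) : ℂ)))) ∧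
    MeasureTheory.IntegrableOn
      (fun x : ℝ => (Real.exp (-2 * Real.pi * k * x) : ℂ) *
        Complex.sin (s * (Real.arctan (x / a) : ℂ)) / ((a ^ 2 + x ^ 2 : ℝ) : ℂ) ^ (s / 2))
      (Set.Ioi 0) ∧
    ∫ x in Set.Ioi (0 : ℝ), (Real.exp (-2 * Real.pi * k * x) : ℂ) *
        Complex.sin (s * (Real.arctan (x / a) : ℂ)) / ((a ^ 2 + x ^ 2 : ℝ) : ℂ) ^ (s / 2) =
      s * (Real.sqrt a : ℂ) * ((2 * Real.pi * k : ℝ) : ℂ) ^ (s - 1 / 2) *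
        lommelS (-s - 1 / 2) (1 / 2) ((2 * Real.pi * a * k : ℝ) : ℂ) := by
  have hk' : (0 : ℝ) < k := by exact_mod_cast hk
  have hp : 0 < 2 * Real.pi * k := by positivity
  have hz : 0 < 2 * Real.pi * a * k := by positivity
  have hneg : -2 * Real.pi * k = -(2 * Real.pi * k) := by ring
  rw [lommelS_half_eq hz, hneg]
  refine ⟨fun h => ?_, integrableOn_integrand ha hp s, ?_⟩
  · obtain ⟨n, rfl⟩ := (lommelExceptional_half_iff s).1 h
    exact tendsto_lommelFormula_half hz n
  · have ha0 : (a : ℂ) ≠ 0 := by exact_mod_cast ha.ne'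
    have hp0 : ((2 * Real.pi * k : ℝ) : ℂ) ≠ 0 := by exact_mod_cast hp.ne'
    rw [integral_integrand ha hp, show 2 * Real.pi * a * k = 2 * Real.pi * k * a by ring]
    have h1 := mul_lommelHalf s (2 * Real.pi * k * a)
    have h2 : ((2 * Real.pi * k * a : ℝ) : ℂ) ^ (1 / 2 - s) =
        ((2 * Real.pi * k : ℝ) : ℂ) ^ (1 / 2 - s) * (a : ℂ) ^ (1 / 2 - s) := by
      rw [Complex.ofReal_mul, ofReal_mul_cpow hp ha0]
    have h3 : ((2 * Real.pi * k : ℝ) : ℂ) ^ (s - 1 / 2) *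
        ((2 * Real.pi * k : ℝ) : ℂ) ^ (1 / 2 - s) = 1 := by
      rw [← Complex.cpow_add _ _ hp0]; simp
    -- Of a^{1-s}, the part a^{1/2-s} joins the power of z = 2πka; the remainder is the √a of the
    -- statement.
    have h4 : (a : ℂ) ^ (1 - s) = (Real.sqrt a : ℂ) * (a : ℂ) ^ (1 / 2 - s) := by
      rw [Real.sqrt_eq_rpow, Complex.ofReal_cpow ha.le, ← Complex.cpow_add _ _ ha0]
      congr 1
      push_cast
      ring
    rw [h2] at h1
    rw [h4]
    linear_combination (-(Real.sqrt a : ℂ) * ((2 * Real.pi * k : ℝ) : ℂ) ^ (s - 1 / 2)) * h1 -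
      ((Real.sqrt a : ℂ) * (a : ℂ) ^ (1 / 2 - s) *
        laplaceSinArctan s (2 * Real.pi * k * a)) * h3
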